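/- Let $\mathfrak g=\mathfrak g_{\bar 0}\oplus\mathfrak g_{\bar 1}$ be a finite-dimensional complex Lie superalgebra with an even, supersymmetric, invariant ($([x,y]\mid w)=(x\mid[y,w])$), non-degenerate bilinear form $(\cdot\mid\cdot)$. Let $e_1,\dots,e_d$ be a homogeneous basis of $\mathfrak g$, $a_{ij}=(e_i\mid e_j)$ and $(b_{ij})=(a_{ij})^{-1}$. The Kac–Moody superalgebra is $$\widehat{\mathfrak g^{(1)}}=\mathfrak g\otimes\mathbb C[t,t^{-1}]\oplus\mathbb C u\oplus\mathbb C z,$$ where $u$ and $z$ are even and $t^nx$ has the parity of $x$, with the bracket $$[t^mx,t^ny]=t^{m+n}[x,y]+m\,\delta_{m,-n}(x\mid y)\,z,\qquad [z,X]=0,\qquad [u,t^nx]=n\,t^nx$$ for $x,y\in\mathfrak g$, $m,n\in\mathbb Z$, $X\in\widehat{\mathfrak g^{(1)}}$. Let $\widehat U(\widehat{\mathfrak g^{(1)}})$ be the space of formal infinite linear combinations of words $c_1\otimes\dots\otimes c_k$ ($k\ge 0$) in the basis $\{t^ne_i\}_{n\in\mathbb Z,\,1\le i\le d}\cup\{u,z\}$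 of $\widehat{\mathfrak g^{(1)}}$, modulo those finite linear combinations of words which vanish in the universal enveloping superalgebra $U(\widehat{\mathfrak g^{(1)}})$; it contains $U(\widehat{\mathfrak g^{(1)}})$. For $X\in\widehat{\mathfrak g^{(1)}}$ the supercommutator $[X,\cdot\,]$ of $U(\widehat{\mathfrak g^{(1)}})$ extends to $\widehat U(\widehat{\mathfrak g^{(1)}})$ term by term, through the Leibniz rule $$[X,c_1\otimes\dots\otimes c_k]=\sum_{i=1}^k(-1)^{p(X)(p(c_1)+\dots+p(c_{i-1}))}\,c_1\otimes\dots\otimes[X,c_i]\otimes\dots\otimes c_k$$ for homogeneous $X$, where $p$ denotes parity (each word receives contributions from only finitely many words). Put $$\Omega'=\sum_{n\in\mathbb Z}\ \sum_{i,j=1}^d b_{ij}\,t^ne_i\otimes t^{-n}e_j\ \in\ \widehat U(\widehat{\mathfrak g^{(1)}}).$$ Then $[X,\ 2u\otimes z+\Omega']=0$ for every $X\in\widehat{\mathfrak g^{(1)}}$. -/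

import Mathlib

namespace SuperCasimir

/-- The sign `(-1)^{ab}` of the Sign Rule, for parities `a, b ∈ ℤ/2`. -/
noncomputable def sgn (a b : ZMod 2) : ℂ := (-1) ^ (a.val * b.val)

theorem zmod2_cases (a : ZMod 2) : a = 0 ∨ a = 1 := by
  fin_cases a
  · exact Or.inl rfl
  · exact Or.inr rfl

@[simp] theorem sgn_zero_left (b : ZMod 2) : sgn 0 b = 1 := by simp [sgn]
@[simp] theorem sgn_zero_right (a : ZMod 2) : sgn a 0 = 1 := by simp [sgn]
@[simp] theorem sgn_one_one : sgn 1 1 = -1 := by simp [sgn, ZMod.val_one]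

theorem sgn_comm (a b : ZMod 2) : sgn a b = sgn b a := by simp [sgn, mul_comm]

theorem sgn_mul_self (a b : ZMod 2) : sgn a b * sgn a b = 1 := by
  rcases zmod2_cases a with rfl | rfl <;> rcases zmod2_cases b with rfl | rfl <;> simp

theorem sgn_add_right (a b c : ZMod 2) : sgn a (b + c) = sgn a b * sgn a c := by
  have h : (1 + 1 : ZMod 2) = 0 := rfl
  rcases zmod2_cases a with rfl | rfl <;> rcases zmod2_cases b with rfl | rfl <;>
    rcases zmod2_cases c with rfl | rfl <;> simp [h]

/-- A complex Lie superalgebra structure on the vector space `V`: `parity 0` is the even part,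
`parity 1` the odd part. -/
structure LieSuperalgebra (V : Type*) [AddCommGroup V] [Module ℂ V] where
  parity : ZMod 2 → Submodule ℂ V
  isCompl : IsCompl (parity 0) (parity 1)
  bracket : V →ₗ[ℂ] V →ₗ[ℂ] V
  bracket_mem : ∀ {a b : ZMod 2} {x y : V}, x ∈ parity a → y ∈ parity b →
    bracket x y ∈ parity (a + b)
  skew : ∀ {a b : ZMod 2} {x y : V}, x ∈ parity a → y ∈ parity b →
    bracket x y = -(sgn a b • bracket y x)
  jacobi : ∀ {a b c : ZMod 2} {x y z : V}, x ∈ parity a → y ∈ parity b → z ∈ parity c →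
    bracket x (bracket y z) = bracket (bracket x y) z + sgn a b • bracket y (bracket x z)

/-- An even invariant non-degenerate supersymmetric bilinear form on a Lie superalgebra. -/
structure EvenInvariantForm {V : Type*} [AddCommGroup V] [Module ℂ V]
    (L : LieSuperalgebra V) where
  form : V →ₗ[ℂ] V →ₗ[ℂ] ℂ
  even : ∀ {a b : ZMod 2} {x y : V}, x ∈ L.parity a → y ∈ L.parity b → a ≠ b → form x y = 0
  supersymm : ∀ {a b : ZMod 2} {x y : V}, x ∈ L.parity a → y ∈ L.parity b →
    form x y = sgn a b • form y x
  invariant : ∀ x y z : V, form (L.bracket x y) z = form x (L.bracket y z)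
  nondegenerate : form.Nondegenerate

section Affine

variable {V : Type*} [AddCommGroup V] [Module ℂ V]

/-- The underlying space of the Kac–Moody superalgebra, `(V ⊗ ℂ[t, t⁻¹]) ⊕ ℂ u ⊕ ℂ z`. A Laurent
polynomial `∑ tⁿ xₙ` with coefficients in `V` is the finitely supported function `n ↦ xₙ`. -/
abbrev Affine (V : Type*) [AddCommGroup V] [Module ℂ V] : Type _ := (ℤ →₀ V) × ℂ × ℂ

/-- The element `tⁿ x`. -/
noncomputable def Affine.t (n : ℤ) (x : V) : Affine V := (Finsupp.single n x, 0, 0)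

/-- The element `u = t d/dt`. -/
noncomputable def Affine.u : Affine V := (0, 1, 0)

/-- The central element `z`. -/
noncomputable def Affine.z : Affine V := (0, 0, 1)

/-- The loop bracket `[tᵐ x, tⁿ y] = tᵐ⁺ⁿ [x, y]`. -/
noncomputable def loopBracket (L : LieSuperalgebra V) :
    (ℤ →₀ V) →ₗ[ℂ] (ℤ →₀ V) →ₗ[ℂ] (ℤ →₀ V) :=
  Finsupp.lsum ℂ fun m => LinearMap.flip <| Finsupp.lsum ℂ fun n =>
    LinearMap.flip (L.bracket.compr₂ (Finsupp.lsingle (m + n)))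

/-- The cocycle `(tᵐ x, tⁿ y) ↦ m δ_{m,-n} (x | y)`. -/
noncomputable def loopCocycle (B : V →ₗ[ℂ] V →ₗ[ℂ] ℂ) :
    (ℤ →₀ V) →ₗ[ℂ] (ℤ →₀ V) →ₗ[ℂ] ℂ :=
  Finsupp.lsum ℂ fun m => LinearMap.flip <| Finsupp.lsum ℂ fun n =>
    LinearMap.flip ((if m = -n then (m : ℂ) else 0) • B)

/-- The derivation `t d/dt`, `tⁿ x ↦ n tⁿ x`. -/
noncomputable def loopDegree : (ℤ →₀ V) →ₗ[ℂ] (ℤ →₀ V) :=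
  Finsupp.lsum ℂ fun n => (n : ℂ) • Finsupp.lsingle n

@[simp] theorem loopBracket_single (L : LieSuperalgebra V) (m n : ℤ) (x y : V) :
    loopBracket L (Finsupp.single m x) (Finsupp.single n y)
      = Finsupp.single (m + n) (L.bracket x y) := by
  simp [loopBracket]

@[simp] theorem loopCocycle_single (B : V →ₗ[ℂ] V →ₗ[ℂ] ℂ) (m n : ℤ) (x y : V) :
    loopCocycle B (Finsupp.single m x) (Finsupp.single n y)
      = if m = -n then (m : ℂ) * B x y else 0 := by
  simp only [loopCocycle, Finsupp.lsum_single, LinearMap.flip_apply, LinearMap.smul_apply,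
    smul_eq_mul]
  split_ifs <;> simp

@[simp] theorem loopDegree_single (n : ℤ) (x : V) :
    loopDegree (Finsupp.single n x) = (n : ℂ) • Finsupp.single n x := by
  simp [loopDegree]

/-- The bracket of the Kac–Moody superalgebra: `z` is central, `u` acts on Laurent polynomials
as `t d/dt`, and Laurent polynomials are bracketed by the loop bracket plus the cocycle
times `z`. -/
noncomputable def affineBracket (L : LieSuperalgebra V) (B : V →ₗ[ℂ] V →ₗ[ℂ] ℂ) :
    Affine V →ₗ[ℂ] Affine V →ₗ[ℂ] Affine V :=
  LinearMap.mk₂ ℂ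
    (fun X Y => (loopBracket L X.1 Y.1 + X.2.1 • loopDegree Y.1 - Y.2.1 • loopDegree X.1,
      0, loopCocycle B X.1 Y.1))
    (by intro X X' Y; ext <;> simp; module)
    (by intro c X Y; ext <;> simp; module)
    (by intro X Y Y'; ext <;> simp; module)
    (by intro c X Y; ext <;> simp; module)

theorem affineBracket_apply (L : LieSuperalgebra V) (B : V →ₗ[ℂ] V →ₗ[ℂ] ℂ) (X Y : Affine V) :
    affineBracket L B X Y =
      (loopBracket L X.1 Y.1 + X.2.1 • loopDegree Y.1 - Y.2.1 • loopDegree X.1,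
        0, loopCocycle B X.1 Y.1) := rfl

/-- Parity of the Kac–Moody superalgebra: `tⁿ x` has the parity of `x`, and `u`, `z` are even. -/
def affineParity (L : LieSuperalgebra V) (a : ZMod 2) : Submodule ℂ (Affine V) where
  carrier := {X | (∀ n, X.1 n ∈ L.parity a) ∧ (a = 1 → X.2 = 0)}
  zero_mem' := by simp
  add_mem' := by
    rintro X Y ⟨h1, h2⟩ ⟨h3, h4⟩
    refine ⟨fun n => by simpa using add_mem (h1 n) (h3 n), fun h => ?_⟩
    simp [h2 h, h4 h]
  smul_mem' := by
    rintro c X ⟨h1, h2⟩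
    refine ⟨fun n => by simpa using Submodule.smul_mem _ c (h1 n), fun h => ?_⟩
    simp [h2 h]

theorem affine_bracket_t (L : LieSuperalgebra V) (B : V →ₗ[ℂ] V →ₗ[ℂ] ℂ) (m n : ℤ) (x y : V) :
    affineBracket L B (Affine.t m x) (Affine.t n y) =
      Affine.t (m + n) (L.bracket x y) + (if m = -n then (m : ℂ) * B x y else 0) • Affine.z := by
  split_ifs with h <;> simp [affineBracket_apply, Affine.t, Affine.z, h]

theorem affine_bracket_z (L : LieSuperalgebra V) (B : V →ₗ[ℂ] V →ₗ[ℂ] ℂ) (X : Affine V) :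
    affineBracket L B Affine.z X = 0 := by
  simp [affineBracket_apply, Affine.z]

theorem affine_bracket_u (L : LieSuperalgebra V) (B : V →ₗ[ℂ] V →ₗ[ℂ] ℂ) (n : ℤ) (x : V) :
    affineBracket L B Affine.u (Affine.t n x) = (n : ℂ) • Affine.t n x := by
  simp [affineBracket_apply, Affine.u, Affine.t]

/-- Induction on elements of given parity of the Kac–Moody superalgebra. -/
theorem affine_induction (L : LieSuperalgebra V) {a : ZMod 2} {P : Affine V → Prop}
    (h0 : P 0) (hadd : ∀ X Y, P X → P Y → P (X + Y))
    (ht : ∀ n x, x ∈ L.parity a → P (Finsupp.single n x, 0, 0))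
    (huz : a = 0 → ∀ c d : ℂ, P (0, c, d))
    {X : Affine V} (hX : X ∈ affineParity L a) : P X := by
  obtain ⟨f, cd⟩ := X
  obtain ⟨h1, h2⟩ := hX
  have e : ((f, cd) : Affine V) = (f, 0) + (0, cd) := by simp
  rw [e]
  apply hadd
  · have key : ∀ f : ℤ →₀ V, (∀ n, f n ∈ L.parity a) → P (f, 0, 0) := by
      intro f
      induction f using Finsupp.induction with
      | zero => intro _; exact h0
      | single_add n x g hn hx ih =>
        intro h
        have hg : ∀ k, g k ∈ L.parity a := by
          intro k
          by_cases hk : k = n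
          · subst hk
            rw [Finsupp.notMem_support_iff.mp hn]; exact zero_mem _
          · have := h k
            rwa [Finsupp.add_apply, Finsupp.single_eq_of_ne hk, zero_add] at this
        have hxm : x ∈ L.parity a := by
          have := h n
          rwa [Finsupp.add_apply, Finsupp.single_eq_same, Finsupp.notMem_support_iff.mp hn,
            add_zero] at this
        have := hadd _ _ (ht n x hxm) (ih hg)
        simpa using this
    exact key f h1
  · rcases zmod2_cases a with rfl | rfl
    · exact huz rfl cd.1 cd.2
    · have : cd = 0 := h2 rfl
      rw [this]; exact h0

/-- The Kac–Moody Lie superalgebra built from a Lie superalgebra with an even invariant form. -/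
noncomputable def affine (L : LieSuperalgebra V) (B : EvenInvariantForm L) :
    LieSuperalgebra (Affine V) where
  parity := affineParity L
  isCompl := by
    constructor
    · rw [Submodule.disjoint_def]
      rintro ⟨f, cd⟩ ⟨h1, -⟩ ⟨h2, h3⟩
      have hf : f = 0 := by
        ext n
        exact (Submodule.disjoint_def.mp L.isCompl.disjoint) _ (h1 n) (h2 n)
      have : cd = 0 := h3 rfl
      simp [hf, this]
    · rw [codisjoint_iff, eq_top_iff]
      rintro ⟨f, cd⟩ -
      have e : ((f, cd) : Affine V) = (f, 0) + (0, cd) := by simp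
      rw [e]
      refine add_mem ?_ (Submodule.mem_sup_left ⟨by simp, by simp⟩)
      induction f using Finsupp.induction_linear with
      | zero => exact zero_mem _
      | add f g hf hg => simpa using add_mem (hf (by simp)) (hg (by simp))
      | single n x =>
        have hx : x ∈ L.parity 0 ⊔ L.parity 1 := by
          rw [codisjoint_iff.mp L.isCompl.codisjoint]; trivial
        obtain ⟨y, hy, w, hw, rfl⟩ := Submodule.mem_sup.mp hx
        have e2 : ((Finsupp.single n (y + w), 0) : Affine V)
            = (Finsupp.single n y, 0) + (Finsupp.single n w, 0) := by simp
        rw [e2]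
        refine Submodule.add_mem_sup ⟨fun k => ?_, by simp⟩ ⟨fun k => ?_, by simp⟩
        · by_cases hk : k = n
          · subst hk; simpa using hy
          · simp [Finsupp.single_eq_of_ne hk]
        · by_cases hk : k = n
          · subst hk; simpa using hw
          · simp [Finsupp.single_eq_of_ne hk]
  bracket := affineBracket L B.form
  bracket_mem := by
    intro a b X Y hX hY
    have hs : ∀ (a : ZMod 2) (n : ℤ) (x : V), x ∈ L.parity a → ∀ k,
        (Finsupp.single n x) k ∈ L.parity a := by
      intro a n x hx k
      by_cases hk : k = n
      · subst hk; simpa using hx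
      · simp [Finsupp.single_eq_of_ne hk]
    refine affine_induction L (P := fun X => affineBracket L B.form X Y ∈ affineParity L (a + b))
      (by simp) (fun X X' h h' => by simpa using add_mem h h') ?_ ?_ hX
    · intro m x hx
      refine affine_induction L
        (P := fun Y => affineBracket L B.form (Finsupp.single m x, 0, 0) Y
          ∈ affineParity L (a + b))
        (by simp) (fun X X' h h' => by simpa using add_mem h h') ?_ ?_ hY
      · intro n y hy
        refine ⟨?_, ?_⟩
        · simpa [affineBracket_apply] using hs _ _ _ (L.bracket_mem hx hy)
        · intro hab
          have hne : a ≠ b := by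
            rintro rfl
            rcases zmod2_cases a with rfl | rfl <;> revert hab <;> decide
          simp [affineBracket_apply, B.even hx hy hne]
      · rintro rfl c d
        refine ⟨?_, ?_⟩
        · intro k
          have := Submodule.smul_mem _ c (Submodule.smul_mem _ (m : ℂ) (hs _ m x hx k))
          simpa [affineBracket_apply, -Finsupp.smul_single] using this
        · simp [affineBracket_apply]
    · rintro rfl c d
      refine affine_induction L
        (P := fun Y => affineBracket L B.form (0, c, d) Y ∈ affineParity L (0 + b))
        (by simp) (fun X X' h h' => by simpa using add_mem h h') ?_ ?_ hY
      · intro n y hy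
        refine ⟨?_, ?_⟩
        · intro k
          have := Submodule.smul_mem _ c (Submodule.smul_mem _ (n : ℂ) (hs _ n y hy k))
          simpa [affineBracket_apply, -Finsupp.smul_single] using this
        · simp [affineBracket_apply]
      · rintro rfl c' d'
        refine ⟨?_, ?_⟩ <;> simp [affineBracket_apply]
  skew := by
    intro a b X Y hX hY
    refine affine_induction L
      (P := fun X => affineBracket L B.form X Y = -(sgn a b • affineBracket L B.form Y X))
      (by simp) (fun X X' h h' => by
        rw [map_add, LinearMap.add_apply, h, h', map_add, smul_add, neg_add]) ?_ ?_ hX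
    · intro m x hx
      refine affine_induction L
        (P := fun Y => affineBracket L B.form (Finsupp.single m x, 0, 0) Y
          = -(sgn a b • affineBracket L B.form Y (Finsupp.single m x, 0, 0)))
        (by simp) (fun X X' h h' => by
          rw [map_add, map_add, h, h', LinearMap.add_apply, smul_add, neg_add]) ?_ ?_ hY
      · intro n y hy
        have h1 := L.skew hx hy
        have h2 := B.supersymm hx hy
        simp only [affineBracket_apply, loopBracket_single, loopCocycle_single, zero_smul,
          add_zero, sub_zero, h1, h2]
        refine Prod.ext ?_ (Prod.ext (by simp) ?_)
        · simp [add_comm]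
        · by_cases hmn : m = -n
          · subst hmn; simp; ring
          · have : n ≠ -m := fun h => hmn (by omega)
            simp [hmn, this]
      · rintro rfl c d
        simp [affineBracket_apply]
    · rintro rfl c d
      refine affine_induction L
        (P := fun Y => affineBracket L B.form (0, c, d) Y
          = -(sgn 0 b • affineBracket L B.form Y (0, c, d)))
        (by simp) (fun X X' h h' => by
          rw [map_add, map_add, h, h', LinearMap.add_apply, smul_add, neg_add]) ?_ ?_ hY
      · intro n y hy
        simp [affineBracket_apply]
      · rintro rfl c' d'
        simp [affineBracket_apply]
  jacobi := by
    intro a b c X Y Z hX hY hZ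
    refine affine_induction L (P := fun X => affineBracket L B.form X (affineBracket L B.form Y Z)
        = affineBracket L B.form (affineBracket L B.form X Y) Z
          + sgn a b • affineBracket L B.form Y (affineBracket L B.form X Z))
      (by simp) (fun X X' h h' => by
        simp only [map_add, LinearMap.add_apply, h, h', smul_add]; abel) ?_ ?_ hX
    · intro m x hx
      refine affine_induction L
        (P := fun Y => affineBracket L B.form (Finsupp.single m x, 0, 0)
            (affineBracket L B.form Y Z)
          = affineBracket L B.form (affineBracket L B.form (Finsupp.single m x, 0, 0) Y) Z
            + sgn a b • affineBracket L B.form Y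
              (affineBracket L B.form (Finsupp.single m x, 0, 0) Z))
        (by simp) (fun X X' h h' => by
          simp only [map_add, LinearMap.add_apply, h, h', smul_add]; abel) ?_ ?_ hY
      · intro n y hy
        refine affine_induction L
          (P := fun Z => affineBracket L B.form (Finsupp.single m x, 0, 0)
              (affineBracket L B.form (Finsupp.single n y, 0, 0) Z)
            = affineBracket L B.form (affineBracket L B.form (Finsupp.single m x, 0, 0)
                (Finsupp.single n y, 0, 0)) Z
              + sgn a b • affineBracket L B.form (Finsupp.single n y, 0, 0)
                (affineBracket L B.form (Finsupp.single m x, 0, 0) Z))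
          (by simp) (fun X X' h h' => by
            simp only [map_add, h, h', smul_add]; abel) ?_ ?_ hZ
        · intro k w hw
          have h1 := L.jacobi hx hy hw
          have h2 : B.form y (L.bracket x w) = -(sgn a b * B.form (L.bracket x y) w) := by
            rw [← B.invariant, L.skew hx hy]
            simp only [map_neg, map_smul, LinearMap.neg_apply, LinearMap.smul_apply, smul_eq_mul]
            linear_combination (-(B.form (L.bracket y x) w)) * sgn_mul_self a b
          simp only [affineBracket_apply, loopBracket_single, loopCocycle_single, zero_smul,
            add_zero, sub_zero]
          refine Prod.ext ?_ (Prod.ext (by simp) ?_)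
          · simp only [Prod.fst_add, Prod.smul_fst, Finsupp.smul_single, h1]
            rw [show n + (m + k) = m + (n + k) by ring, show m + n + k = m + (n + k) by ring,
              ← Finsupp.single_add]
          · simp only [Prod.snd_add, Prod.smul_snd, smul_eq_mul, h2, ← B.invariant]
            by_cases hs : m = -(n + k)
            · have hs1 : m + n = -k := by omega
              have hs2 : n = -(m + k) := by omega
              rw [if_pos hs, if_pos hs1, if_pos hs2]
              push_cast
              linear_combination ((n : ℂ) * B.form (L.bracket x y) w) * sgn_mul_self a b
            · have hs1 : ¬ m + n = -k := by omega
              have hs2 : ¬ n = -(m + k) := by omega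
              rw [if_neg hs, if_neg hs1, if_neg hs2]; simp
        · rintro rfl p q
          have h2 : B.form y x = sgn a b * B.form x y := by
            rw [B.supersymm hy hx, sgn_comm]; rfl
          have h3 : L.bracket y x = -(sgn a b • L.bracket x y) := by
            rw [L.skew hy hx, sgn_comm]
          simp only [affineBracket_apply, loopBracket_single, loopCocycle_single, zero_smul,
            add_zero, sub_zero, map_zero, zero_sub, loopDegree_single,
            map_neg, map_smul]
          refine Prod.ext ?_ (Prod.ext (by simp) ?_)
          · simp only [Prod.fst_add, Prod.smul_fst, h3, Finsupp.single_neg, add_comm n m,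
              ← Finsupp.smul_single, smul_neg, smul_smul]
            push_cast
            have := sgn_mul_self a b
            match_scalars
            linear_combination (-p * m) * this
          · simp only [Prod.snd_add, Prod.smul_snd, smul_eq_mul, h2]
            by_cases hs : m = -n
            · have hs1 : n = -m := by omega
              rw [if_pos hs, if_pos hs1]
              subst hs
              push_cast
              linear_combination (-(n * p * n * B.form x y)) * sgn_mul_self a b
            · have hs1 : ¬ n = -m := by omega
              rw [if_neg hs, if_neg hs1]; simp
      · rintro rfl p q
        refine affine_induction L
          (P := fun Z => affineBracket L B.form (Finsupp.single m x, 0, 0)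
              (affineBracket L B.form (0, p, q) Z)
            = affineBracket L B.form (affineBracket L B.form (Finsupp.single m x, 0, 0)
                (0, p, q)) Z
              + sgn a 0 • affineBracket L B.form (0, p, q)
                (affineBracket L B.form (Finsupp.single m x, 0, 0) Z))
          (by simp) (fun X X' h h' => by
            simp only [map_add, h, h', smul_add]; abel) ?_ ?_ hZ
        · intro k w hw
          simp only [affineBracket_apply, loopBracket_single, loopCocycle_single, zero_smul,
            add_zero, sub_zero, map_zero, LinearMap.zero_apply, zero_sub, zero_add,
            loopDegree_single, map_neg, map_smul, sgn_zero_right, one_smul,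
            LinearMap.neg_apply, LinearMap.smul_apply]
          refine Prod.ext ?_ (Prod.ext (by simp) ?_)
          · simp only [Prod.fst_add]
            push_cast
            module
          · simp only [Prod.snd_add, smul_eq_mul]
            by_cases hs : m = -k
            · subst hs; simp
            · simp [hs]
        · rintro rfl p' q'
          simp [affineBracket_apply, smul_smul, mul_left_comm]
    · rintro rfl p q
      refine affine_induction L
        (P := fun Y => affineBracket L B.form (0, p, q) (affineBracket L B.form Y Z)
          = affineBracket L B.form (affineBracket L B.form (0, p, q) Y) Z
            + sgn 0 b • affineBracket L B.form Y (affineBracket L B.form (0, p, q) Z))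
        (by simp) (fun X X' h h' => by
          simp only [map_add, LinearMap.add_apply, h, h', smul_add]; abel) ?_ ?_ hY
      · intro n y hy
        refine affine_induction L
          (P := fun Z => affineBracket L B.form (0, p, q)
              (affineBracket L B.form (Finsupp.single n y, 0, 0) Z)
            = affineBracket L B.form (affineBracket L B.form (0, p, q)
                (Finsupp.single n y, 0, 0)) Z
              + sgn 0 b • affineBracket L B.form (Finsupp.single n y, 0, 0)
                (affineBracket L B.form (0, p, q) Z))
          (by simp) (fun X X' h h' => by
            simp only [map_add, h, h', smul_add]; abel) ?_ ?_ hZ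
        · intro k w hw
          simp only [affineBracket_apply, loopBracket_single, loopCocycle_single, zero_smul,
            add_zero, sub_zero, map_zero, LinearMap.zero_apply, zero_sub, zero_add,
            loopDegree_single, map_neg, map_smul, sgn_zero_left, one_smul,
            LinearMap.neg_apply, LinearMap.smul_apply]
          refine Prod.ext ?_ (Prod.ext (by simp) ?_)
          · simp only [Prod.fst_add]
            push_cast
            module
          · simp only [Prod.snd_add, smul_eq_mul]
            by_cases hs : n = -k
            · subst hs; simp
            · simp [hs]
        · rintro rfl p' q'
          simp [affineBracket_apply, smul_smul, mul_left_comm]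
      · rintro rfl p' q'
        refine affine_induction L
          (P := fun Z => affineBracket L B.form (0, p, q)
              (affineBracket L B.form (0, p', q') Z)
            = affineBracket L B.form (affineBracket L B.form (0, p, q) (0, p', q')) Z
              + sgn 0 0 • affineBracket L B.form (0, p', q')
                (affineBracket L B.form (0, p, q) Z))
          (by simp) (fun X X' h h' => by
            simp only [map_add, h, h', smul_add]; abel) ?_ ?_ hZ
        · intro k w hw
          simp [affineBracket_apply, smul_smul, mul_left_comm]
        · intro _ p'' q''
          simp [affineBracket_apply]

end Affine

section Enveloping

variable {W : Type*} [AddCommGroup W] [Module ℂ W]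

/-- The relations `x ⊗ y = (-1)^{p(x)p(y)} y ⊗ x + [x, y]`, for homogeneous `x`, `y`, of the
universal enveloping algebra. -/
inductive EnvRel (L : LieSuperalgebra W) : TensorAlgebra ℂ W → TensorAlgebra ℂ W → Prop
  | comm {a b : ZMod 2} {x y : W} (hx : x ∈ L.parity a) (hy : y ∈ L.parity b) :
      EnvRel L (TensorAlgebra.ι ℂ x * TensorAlgebra.ι ℂ y)
        (sgn a b • (TensorAlgebra.ι ℂ y * TensorAlgebra.ι ℂ x) + TensorAlgebra.ι ℂ (L.bracket x y))

/-- The universal enveloping algebra `U(L)` of a Lie superalgebra. -/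
abbrev Env (L : LieSuperalgebra W) : Type _ := RingQuot (EnvRel L)

/-- The projection of the tensor algebra onto `U(L)`. -/
noncomputable def Env.proj (L : LieSuperalgebra W) : TensorAlgebra ℂ W →ₐ[ℂ] Env L :=
  RingQuot.mkAlgHom ℂ (EnvRel L)

/-- The canonical map `L → U(L)`. -/
noncomputable def Env.ι (L : LieSuperalgebra W) : W →ₗ[ℂ] Env L :=
  (Env.proj L).toLinearMap ∘ₗ TensorAlgebra.ι ℂ

theorem Env.proj_surjective (L : LieSuperalgebra W) : Function.Surjective (Env.proj L) :=
  RingQuot.mkAlgHom_surjective ℂ (EnvRel L)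

@[simp] theorem Env.proj_ι (L : LieSuperalgebra W) (x : W) :
    Env.proj L (TensorAlgebra.ι ℂ x) = Env.ι L x := rfl

theorem Env.comm (L : LieSuperalgebra W) {a b : ZMod 2} {x y : W} (hx : x ∈ L.parity a)
    (hy : y ∈ L.parity b) :
    Env.ι L x * Env.ι L y = sgn a b • (Env.ι L y * Env.ι L x) + Env.ι L (L.bracket x y) := by
  have := RingQuot.mkAlgHom_rel ℂ (EnvRel.comm hx hy)
  simpa [Env.ι, Env.proj] using this

/-- The map `y ↦ (-1)^{a p(y)} y` on a Lie superalgebra. -/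
noncomputable def signMap (L : LieSuperalgebra W) (a : ZMod 2) : W →ₗ[ℂ] W :=
  Submodule.projection _ _ L.isCompl + sgn a 1 • Submodule.projection _ _ L.isCompl.symm

theorem signMap_apply (L : LieSuperalgebra W) (a : ZMod 2) {b : ZMod 2} {y : W}
    (hy : y ∈ L.parity b) : signMap L a y = sgn a b • y := by
  rcases zmod2_cases b with rfl | rfl
  · simp [signMap, Submodule.projection_apply_of_mem_left L.isCompl hy,
      (Submodule.projection_apply_eq_zero_iff L.isCompl.symm).mpr hy]
  · simp [signMap, Submodule.projection_apply_of_mem_left L.isCompl.symm hy,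
      (Submodule.projection_apply_eq_zero_iff L.isCompl).mpr hy]

/-- The algebra automorphism `Y ↦ (-1)^{a p(Y)} Y` of `U(L)`. -/
noncomputable def Env.sign (L : LieSuperalgebra W) (a : ZMod 2) : Env L →ₐ[ℂ] Env L :=
  RingQuot.liftAlgHom ℂ ⟨TensorAlgebra.lift ℂ (Env.ι L ∘ₗ signMap L a), by
    rintro _ _ ⟨hx, hy⟩
    rename_i b c x y
    have h := signMap_apply L a (L.bracket_mem hx hy)
    simp only [map_mul, map_add, map_smul, TensorAlgebra.lift_ι_apply, LinearMap.comp_apply, h,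
      signMap_apply L a hx, signMap_apply L a hy, smul_mul_smul_comm, Env.comm L hx hy,
      sgn_add_right, smul_add, mul_comm (sgn a c)]
    rw [smul_comm]⟩

theorem Env.sign_ι (L : LieSuperalgebra W) (a : ZMod 2) {b : ZMod 2} {y : W}
    (hy : y ∈ L.parity b) : Env.sign L a (Env.ι L y) = sgn a b • Env.ι L y := by
  have : Env.sign L a (Env.ι L y) = Env.ι L (signMap L a y) := by
    simp [Env.sign, Env.ι, Env.proj]
  rw [this, signMap_apply L a hy, map_smul]

/-- The supercommutator `[x, Y] = x Y - (-1)^{p(x)p(Y)} Y x` in `U(L)` of an element `x ∈ L` of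
parity `a` with an element `Y` of `U(L)`. -/
noncomputable def Env.superComm (L : LieSuperalgebra W) (a : ZMod 2) (x : W) (Y : Env L) : Env L :=
  Env.ι L x * Y - Env.sign L a Y * Env.ι L x

/-- A homogeneous basis of a Lie superalgebra, with parities `p b`, such that for every basis
vector `c` each basis vector occurs in only finitely many of the brackets `[c, a]`, `a` in the
basis, so that bracketing with an element of `L` extends to infinite sums. -/
structure SummableBasis (L : LieSuperalgebra W) (Λ : Type*) where
  basis : Module.Basis Λ ℂ W
  p : Λ → ZMod 2
  mem : ∀ b, basis b ∈ L.parity (p b)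
  finite : ∀ c b, {a | basis.repr (L.bracket (basis c) (basis a)) b ≠ 0}.Finite

variable {L : LieSuperalgebra W} {Λ : Type*} (β : SummableBasis L Λ)

/-- The coefficients of an element of the tensor algebra at the words
`b₁ ⊗ ⋯ ⊗ bₖ` in the basis. -/
noncomputable def coeff : TensorAlgebra ℂ W →ₗ[ℂ] (List Λ → ℂ) :=
  LinearMap.pi fun w =>
    Finsupp.lapply (FreeMonoid.ofList w) ∘ₗ β.basis.tensorAlgebra.repr.toLinearMap

theorem coeff_apply (y : TensorAlgebra ℂ W) (w : List Λ) :
    coeff β y w = β.basis.tensorAlgebra.repr y (FreeMonoid.ofList w) := rfl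

theorem coeff_injective : Function.Injective (coeff β) := by
  intro y y' h
  apply β.basis.tensorAlgebra.repr.injective
  ext w
  exact congrFun h w.toList

theorem tensorBasis_nil : β.basis.tensorAlgebra (FreeMonoid.ofList []) = 1 := by
  have h : (MonoidAlgebra.single (1 : FreeMonoid Λ) (1 : ℂ)) = 1 := rfl
  simp [Module.Basis.tensorAlgebra, FreeAlgebra.basisFreeMonoid, h]

theorem tensorBasis_cons (a : Λ) (w : List Λ) :
    β.basis.tensorAlgebra (FreeMonoid.ofList (a :: w)) =
      TensorAlgebra.ι ℂ (β.basis a) * β.basis.tensorAlgebra (FreeMonoid.ofList w) := by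
  simp [Module.Basis.tensorAlgebra, FreeAlgebra.basisFreeMonoid,
    FreeAlgebra.equivMonoidAlgebraFreeMonoid]

theorem coeff_tensorBasis (v w : List Λ) [Decidable (v = w)] :
    coeff β (β.basis.tensorAlgebra (FreeMonoid.ofList v)) w = if v = w then 1 else 0 := by
  classical
  rw [coeff_apply, Module.Basis.repr_self, Finsupp.single_apply]
  congr 1

/-- Linear induction on the tensor algebra along words in the basis. -/
theorem tensor_induction {P : TensorAlgebra ℂ W → Prop}
    (hadd : ∀ x y, P x → P y → P (x + y)) (hsmul : ∀ (c : ℂ) x, P x → P (c • x))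
    (h1 : P 1) (hcons : ∀ a (w : List Λ),
      P (β.basis.tensorAlgebra (FreeMonoid.ofList w)) →
      P (TensorAlgebra.ι ℂ (β.basis a) * β.basis.tensorAlgebra (FreeMonoid.ofList w)))
    (y : TensorAlgebra ℂ W) : P y := by
  have hy : y ∈ Submodule.span ℂ (Set.range β.basis.tensorAlgebra) := by
    rw [β.basis.tensorAlgebra.span_eq]; trivial
  induction hy using Submodule.span_induction with
  | mem x h =>
    obtain ⟨w, rfl⟩ := h
    have : ∀ w : List Λ, P (β.basis.tensorAlgebra (FreeMonoid.ofList w)) := by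
      intro w
      induction w with
      | nil => rw [tensorBasis_nil]; exact h1
      | cons a w ih => rw [tensorBasis_cons]; exact hcons a w ih
    exact this w.toList
  | zero => simpa using hsmul 0 1 h1
  | add x y _ _ hx hy => exact hadd x y hx hy
  | smul c x _ hx => exact hsmul c x hx

theorem coeff_cons_basis [DecidableEq Λ] (a b : Λ) (y : TensorAlgebra ℂ W) (w : List Λ) :
    coeff β (TensorAlgebra.ι ℂ (β.basis a) * y) (b :: w) = if a = b then coeff β y w else 0 := by
  have key : ∀ v : List Λ,
      coeff β (TensorAlgebra.ι ℂ (β.basis a) * β.basis.tensorAlgebra (FreeMonoid.ofList v))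
        (b :: w)
      = if a = b then coeff β (β.basis.tensorAlgebra (FreeMonoid.ofList v)) w else 0 := by
    intro v
    rw [← tensorBasis_cons, coeff_tensorBasis, coeff_tensorBasis]
    by_cases h : a = b <;> simp [h]
  induction y using tensor_induction β with
  | hadd x y hx hy =>
    rw [mul_add, map_add, Pi.add_apply, hx, hy, map_add, Pi.add_apply]; split_ifs <;> simp
  | hsmul c x hx =>
    rw [mul_smul_comm, map_smul, Pi.smul_apply, hx, map_smul, Pi.smul_apply]; split_ifs <;> simp
  | h1 => rw [← tensorBasis_nil β]; exact key []
  | hcons a' v _ => rw [← tensorBasis_cons]; exact key (a' :: v)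

/-- The coefficient of `b ⊗ w` in `x ⊗ y` is the coefficient of `b` in `x` times the
coefficient of `w` in `y`. -/
theorem coeff_cons (x : W) (y : TensorAlgebra ℂ W) (b : Λ) (w : List Λ) :
    coeff β (TensorAlgebra.ι ℂ x * y) (b :: w) = β.basis.repr x b * coeff β y w := by
  classical
  have h : LinearMap.proj (b :: w) ∘ₗ coeff β ∘ₗ LinearMap.mulRight ℂ y ∘ₗ TensorAlgebra.ι ℂ
      = coeff β y w • β.basis.coord b := by
    refine β.basis.ext fun a => ?_
    have := coeff_cons_basis β a b y w
    simp only [LinearMap.comp_apply, LinearMap.mulRight_apply, LinearMap.proj_apply, this,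
      LinearMap.smul_apply, Module.Basis.coord_apply, Module.Basis.repr_self,
      Finsupp.single_apply, smul_eq_mul]
    split_ifs <;> simp
  have := LinearMap.congr_fun h x
  simpa [mul_comm] using this

theorem coeff_nil (x : W) (y : TensorAlgebra ℂ W) :
    coeff β (TensorAlgebra.ι ℂ x * y) [] = 0 := by
  classical
  have key : ∀ (a : Λ) (v : List Λ),
      coeff β (TensorAlgebra.ι ℂ (β.basis a) * β.basis.tensorAlgebra (FreeMonoid.ofList v)) []
        = 0 := by
    intro a v
    rw [← tensorBasis_cons, coeff_tensorBasis]; simp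
  have h : LinearMap.proj [] ∘ₗ coeff β ∘ₗ LinearMap.mulRight ℂ y ∘ₗ TensorAlgebra.ι ℂ
      = 0 := by
    refine β.basis.ext fun a => ?_
    simp only [LinearMap.comp_apply, LinearMap.mulRight_apply, LinearMap.proj_apply,
      LinearMap.zero_apply]
    induction y using tensor_induction β with
    | hadd x y hx hy => rw [mul_add, map_add, Pi.add_apply, hx, hy, add_zero]
    | hsmul c x hx => rw [mul_smul_comm, map_smul, Pi.smul_apply, hx, smul_zero]
    | h1 => rw [← tensorBasis_nil β]; exact key a []
    | hcons a' v _ => rw [← tensorBasis_cons]; exact key a (a' :: v)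
  simpa using LinearMap.congr_fun h x

/-- Bracketing a formal infinite sum of words `f` (given by its coefficients) with the basis
vector `c`, by the Leibniz rule
`[c, a₁ ⊗ ⋯ ⊗ aₖ] = ∑ᵢ ± a₁ ⊗ ⋯ ⊗ [c, aᵢ] ⊗ ⋯ ⊗ aₖ`, the sign being that of the Sign Rule:
this is the coefficient of the result at a given word. -/
noncomputable def adWord (c : Λ) : List Λ → (List Λ → ℂ) → ℂ
  | [], _ => 0
  | b :: w, f =>
      (∑ᶠ a : Λ, β.basis.repr (L.bracket (β.basis c) (β.basis a)) b * f (a :: w))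
        + sgn (β.p c) (β.p b) * adWord c w (fun v => f (b :: v))

theorem adWord_cons (c b : Λ) (w : List Λ) (f : List Λ → ℂ) :
    adWord β c (b :: w) f =
      (∑ᶠ a : Λ, β.basis.repr (L.bracket (β.basis c) (β.basis a)) b * f (a :: w))
        + sgn (β.p c) (β.p b) * adWord β c w (fun v => f (b :: v)) := rfl

theorem adWord_add (c : Λ) (w : List Λ) (f g : List Λ → ℂ) :
    adWord β c w (f + g) = adWord β c w f + adWord β c w g := by
  induction w generalizing f g with
  | nil => simp [adWord]
  | cons b w ih =>
    have h := ih (fun v => f (b :: v)) (fun v => g (b :: v))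
    have h' : (fun v => (f + g) (b :: v)) = (fun v => f (b :: v)) + (fun v => g (b :: v)) := rfl
    rw [adWord_cons, adWord_cons, adWord_cons, h', h]
    simp only [Pi.add_apply, mul_add]
    rw [finsum_add_distrib]
    · ring
    · exact (β.finite c b).subset fun a ha h0 => ha (by simp [h0])
    · exact (β.finite c b).subset fun a ha h0 => ha (by simp [h0])

theorem adWord_smul (c : Λ) (w : List Λ) (r : ℂ) (f : List Λ → ℂ) :
    adWord β c w (r • f) = r * adWord β c w f := by
  induction w generalizing f with
  | nil => simp [adWord]
  | cons b w ih =>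
    have h := ih (fun v => f (b :: v))
    have h' : (fun v => (r • f) (b :: v)) = r • (fun v => f (b :: v)) := rfl
    rw [adWord_cons, adWord_cons, h', h]
    simp only [Pi.smul_apply, smul_eq_mul, mul_left_comm _ r]
    rw [mul_add, mul_finsum]

/-- Bracketing of formal infinite sums of words with an element of `L`. -/
noncomputable def adFormal : W →ₗ[ℂ] (List Λ → ℂ) →ₗ[ℂ] (List Λ → ℂ) :=
  β.basis.constr ℂ fun c =>
    { toFun := fun f w => adWord β c w f
      map_add' := fun f g => funext fun w => adWord_add β c w f g
      map_smul' := fun r f => funext fun w => adWord_smul β c w r f }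

theorem adFormal_basis (c : Λ) (f : List Λ → ℂ) (w : List Λ) :
    adFormal β (β.basis c) f w = adWord β c w f := by
  simp [adFormal]

theorem adFormal_coeff_one (c : Λ) : adFormal β (β.basis c) (coeff β 1) = 0 := by
  classical
  have h0 : ∀ w : List Λ, adWord β c w 0 = 0 := fun w => by
    have := adWord_smul β c w 0 0
    simpa using this
  funext w
  rw [adFormal_basis]
  cases w with
  | nil => rfl
  | cons b w =>
    have h : ∀ (b : Λ) (w : List Λ), coeff β 1 (b :: w) = 0 := by
      intro b w
      rw [← tensorBasis_nil β, coeff_tensorBasis]; simp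
    have h2 : (fun v => coeff β 1 (b :: v)) = 0 := funext fun v => h b v
    rw [adWord_cons, h2, h0]
    simp [h]

theorem adFormal_coeff_cons (c a : Λ) (y y' : TensorAlgebra ℂ W)
    (h : adFormal β (β.basis c) (coeff β y) = coeff β y') :
    adFormal β (β.basis c) (coeff β (TensorAlgebra.ι ℂ (β.basis a) * y)) =
      coeff β (TensorAlgebra.ι ℂ (L.bracket (β.basis c) (β.basis a)) * y
        + sgn (β.p c) (β.p a) • (TensorAlgebra.ι ℂ (β.basis a) * y')) := by
  classical
  funext w
  rw [adFormal_basis, map_add, map_smul, Pi.add_apply, Pi.smul_apply]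
  cases w with
  | nil => simp [adWord, coeff_nil]
  | cons b w =>
    have h' : adWord β c w (coeff β y) = coeff β y' w := by rw [← h, adFormal_basis]
    have h2 : (fun v => coeff β (TensorAlgebra.ι ℂ (β.basis a) * y) (b :: v))
        = (if a = b then (1 : ℂ) else 0) • coeff β y := by
      funext v
      rw [coeff_cons_basis, Pi.smul_apply]; split_ifs <;> simp
    rw [adWord_cons, h2, adWord_smul, h']
    simp only [coeff_cons]
    rw [finsum_eq_single _ a (fun a' ha' => by simp [ha'.symm])]
    by_cases hab : a = b
    · subst hab; simp
    · simp [hab]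

/-- On finite sums, bracketing by the Leibniz rule is the supercommutator in `U(L)`. -/
theorem adFormal_coeff (c : Λ) (y : TensorAlgebra ℂ W) :
    ∃ y', adFormal β (β.basis c) (coeff β y) = coeff β y' ∧
      Env.proj L y' = Env.superComm L (β.p c) (β.basis c) (Env.proj L y) := by
  induction y using tensor_induction β with
  | hadd x y hx hy =>
    obtain ⟨x', h1, h2⟩ := hx
    obtain ⟨y', h3, h4⟩ := hy
    refine ⟨x' + y', by simp [h1, h3], ?_⟩
    rw [map_add, h2, h4]
    simp only [Env.superComm, map_add]
    noncomm_ring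
  | hsmul r x hx =>
    obtain ⟨x', h1, h2⟩ := hx
    refine ⟨r • x', by simp [h1], ?_⟩
    rw [map_smul, h2]
    simp [Env.superComm, smul_sub]
  | h1 => exact ⟨0, by simp [adFormal_coeff_one], by simp [Env.superComm]⟩
  | hcons a w ih =>
    obtain ⟨y', h1, h2⟩ := ih
    refine ⟨_, adFormal_coeff_cons β c a _ y' h1, ?_⟩
    generalize β.basis.tensorAlgebra (FreeMonoid.ofList w) = y at h2 ⊢
    simp only [map_add, map_smul, map_mul, h2, Env.superComm, Env.proj_ι,
      Env.sign_ι L _ (β.mem a), mul_sub, ← mul_assoc, Env.comm L (β.mem c) (β.mem a), add_mul,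
      smul_mul_assoc, smul_sub]
    abel

/-- The relations of `U(L)`: the finite sums of words which vanish in `U(L)`, inside the space of
formal infinite sums of words. -/
noncomputable def relations : Submodule ℂ (List Λ → ℂ) :=
  (LinearMap.ker (Env.proj L).toLinearMap).map (coeff β)

/-- The completion `Û(L)` of the enveloping algebra: formal infinite sums `∑ f(w) w` of words
`w = b₁ ⊗ ⋯ ⊗ bₖ` in the basis, modulo the relations of `U(L)`. It contains `U(L)`. -/
abbrev EnvHat : Type _ := (List Λ → ℂ) ⧸ relations β

/-- The canonical map `U(L) → Û(L)`. -/
noncomputable def EnvHat.ofEnv : Env L →ₗ[ℂ] EnvHat β :=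
  Submodule.mapQ _ (relations β) (coeff β) (Submodule.map_le_iff_le_comap.mp le_rfl) ∘ₗ
    ((Env.proj L).toLinearMap.quotKerEquivOfSurjective
      (Env.proj_surjective L)).symm.toLinearMap

theorem EnvHat.ofEnv_proj (y : TensorAlgebra ℂ W) :
    EnvHat.ofEnv β (Env.proj L y) = Submodule.Quotient.mk (coeff β y) := by
  have : ((Env.proj L).toLinearMap.quotKerEquivOfSurjective (Env.proj_surjective L)).symm
      (Env.proj L y) = Submodule.Quotient.mk y := by
    rw [LinearEquiv.symm_apply_eq]; rfl
  simp [EnvHat.ofEnv, this]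

theorem EnvHat.ofEnv_injective : Function.Injective (EnvHat.ofEnv β) := by
  rw [injective_iff_map_eq_zero]
  intro Y hY
  obtain ⟨y, rfl⟩ := Env.proj_surjective L Y
  rw [EnvHat.ofEnv_proj, Submodule.Quotient.mk_eq_zero] at hY
  obtain ⟨y', hy', h⟩ := hY
  rw [← coeff_injective β h]
  exact hy'

theorem relations_le (x : W) : relations β ≤ (relations β).comap (adFormal β x) := by
  rintro _ ⟨y, hy, rfl⟩
  have hy' : Env.proj L y = 0 := hy
  rw [Submodule.mem_comap]
  have h : adFormal β x (coeff β y)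
      = (β.basis.repr x).sum fun c r => r • adFormal β (β.basis c) (coeff β y) := by
    conv_lhs => rw [← β.basis.linearCombination_repr x]
    simp [Finsupp.linearCombination_apply, Finsupp.sum, LinearMap.sum_apply]
  rw [h]
  refine Submodule.sum_mem _ fun c _ => Submodule.smul_mem _ _ ?_
  obtain ⟨y', h1, h2⟩ := adFormal_coeff β c y
  rw [h1]
  refine ⟨y', ?_, rfl⟩
  change Env.proj L y' = 0
  rw [h2, hy']
  simp [Env.superComm]

/-- The bracket `[x, Y]` of an element `x` of `L` with an element `Y` of `Û(L)`: the termwise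
extension to infinite sums of the supercommutator of `U(L)`. -/
noncomputable def EnvHat.bracket (x : W) : EnvHat β →ₗ[ℂ] EnvHat β :=
  Submodule.mapQ _ _ (adFormal β x) (relations_le β x)

theorem repr_eq_zero {a : ZMod 2} {x : W} (hx : x ∈ L.parity a) {b : Λ} (hb : β.p b ≠ a) :
    β.basis.repr x b = 0 := by
  have h : β.basis.coord b ∘ₗ signMap L 1 = sgn 1 (β.p b) • β.basis.coord b := by
    classical
    refine β.basis.ext fun c => ?_
    simp only [LinearMap.comp_apply, signMap_apply L 1 (β.mem c), map_smul, LinearMap.smul_apply,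
      Module.Basis.coord_apply, Module.Basis.repr_self, Finsupp.single_apply]
    by_cases h : c = b
    · subst h; simp
    · simp [h]
  have h2 := LinearMap.congr_fun h x
  simp only [LinearMap.comp_apply, signMap_apply L 1 hx, map_smul, LinearMap.smul_apply,
    Module.Basis.coord_apply, smul_eq_mul] at h2
  rcases zmod2_cases a with rfl | rfl <;> rcases zmod2_cases (β.p b) with h3 | h3 <;>
    rw [h3] at hb h2
  · exact absurd rfl hb
  · simp at h2
    linear_combination h2 / 2
  · simp at h2
    linear_combination -h2 / 2
  · exact absurd rfl hb

/-- On `U(L)` the bracket is the supercommutator. -/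
theorem EnvHat.bracket_ofEnv {a : ZMod 2} {x : W} (hx : x ∈ L.parity a) (Y : Env L) :
    EnvHat.bracket β x (EnvHat.ofEnv β Y) = EnvHat.ofEnv β (Env.superComm L a x Y) := by
  have key : ∀ c, EnvHat.bracket β (β.basis c) (EnvHat.ofEnv β Y)
      = EnvHat.ofEnv β (Env.superComm L (β.p c) (β.basis c) Y) := by
    intro c
    obtain ⟨y, rfl⟩ := Env.proj_surjective L Y
    obtain ⟨y', h1, h2⟩ := adFormal_coeff β c y
    rw [← h2, EnvHat.ofEnv_proj, EnvHat.ofEnv_proj, ← h1]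
    rfl
  have e1 : EnvHat.bracket β x (EnvHat.ofEnv β Y) = (β.basis.repr x).sum fun c r =>
      r • EnvHat.bracket β (β.basis c) (EnvHat.ofEnv β Y) := by
    obtain ⟨f, hf⟩ := Submodule.Quotient.mk_surjective _ (EnvHat.ofEnv β Y)
    rw [← hf]
    simp only [EnvHat.bracket, Submodule.mapQ_apply]
    conv_lhs => rw [← β.basis.linearCombination_repr x]
    simp only [Finsupp.linearCombination_apply, Finsupp.sum, LinearMap.sum_apply, map_sum,
      map_smul, LinearMap.smul_apply]
    exact map_sum (Submodule.mkQ (relations β)) _ _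
  have e2 : EnvHat.ofEnv β (Env.superComm L a x Y) = (β.basis.repr x).sum fun c r =>
      r • EnvHat.ofEnv β (Env.superComm L a (β.basis c) Y) := by
    have h : ∀ x, Env.superComm L a x Y =
        (LinearMap.mulRight ℂ Y ∘ₗ Env.ι L - LinearMap.mulLeft ℂ (Env.sign L a Y) ∘ₗ Env.ι L) x :=
      fun x => rfl
    simp only [h]
    conv_lhs => rw [← β.basis.linearCombination_repr x]
    rw [Finsupp.linearCombination_apply, map_finsuppSum, map_finsuppSum]
    simp only [map_smul]
  rw [e1, e2]
  refine Finset.sum_congr rfl fun c hc => ?_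
  have : β.p c = a := by
    by_contra hne
    exact (Finsupp.mem_support_iff.mp hc) (repr_eq_zero β hx hne)
  simp only [key c, this]

/-- The element `∑ₙ vₙ` of `Û(L)`, for finite sums `vₙ` of words such that each word occurs in
only finitely many `vₙ`. -/
noncomputable def EnvHat.sum {κ : Type*} (v : κ → TensorAlgebra ℂ W) : EnvHat β :=
  Submodule.Quotient.mk fun w => ∑ᶠ n, coeff β (v n) w

end Enveloping

section Casimir

variable {V : Type*} [AddCommGroup V] [Module ℂ V] {ι : Type*}

/-- The basis `tⁿ eᵢ` (`n ∈ ℤ`), `u`, `z` of the Kac–Moody superalgebra. -/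
noncomputable def affineLetters (e : Module.Basis ι ℂ V) :
    Module.Basis ((Σ _ : ℤ, ι) ⊕ Unit ⊕ Unit) ℂ (Affine V) :=
  (Finsupp.basis fun _ : ℤ => e).prod
    ((Module.Basis.singleton Unit ℂ).prod (Module.Basis.singleton Unit ℂ))

theorem affineLetters_t (e : Module.Basis ι ℂ V) (n : ℤ) (i : ι) :
    affineLetters e (Sum.inl ⟨n, i⟩) = Affine.t n (e i) := by
  simp [affineLetters, Affine.t, Finsupp.coe_basis, Prod.ext_iff]

theorem affineLetters_u (e : Module.Basis ι ℂ V) :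
    affineLetters e (Sum.inr (Sum.inl ())) = Affine.u := by
  simp [affineLetters, Affine.u]

theorem affineLetters_z (e : Module.Basis ι ℂ V) :
    affineLetters e (Sum.inr (Sum.inr ())) = Affine.z := by
  simp [affineLetters, Affine.z]

theorem affineLetters_repr_t (e : Module.Basis ι ℂ V) (X : Affine V) (n : ℤ) (i : ι) :
    (affineLetters e).repr X (Sum.inl ⟨n, i⟩) = e.repr (X.1 n) i := by
  simp [affineLetters]

theorem affineLetters_repr_u (e : Module.Basis ι ℂ V) (X : Affine V) :
    (affineLetters e).repr X (Sum.inr (Sum.inl ())) = X.2.1 := by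
  simp [affineLetters]

theorem affineLetters_repr_z (e : Module.Basis ι ℂ V) (X : Affine V) :
    (affineLetters e).repr X (Sum.inr (Sum.inr ())) = X.2.2 := by
  simp [affineLetters]

/-- The basis `tⁿ eᵢ`, `u`, `z` of the Kac–Moody superalgebra, with its parities. -/
noncomputable def affineBasis [Finite ι] (L : LieSuperalgebra V) (B : EvenInvariantForm L)
    (e : Module.Basis ι ℂ V) (p : ι → ZMod 2) (he : ∀ i, e i ∈ L.parity (p i)) :
    SummableBasis (affine L B) ((Σ _ : ℤ, ι) ⊕ Unit ⊕ Unit) where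
  basis := affineLetters e
  p := Sum.elim (fun k => p k.2) fun _ => 0
  mem := by
    rintro (⟨n, i⟩ | ⟨⟨⟩⟩ | ⟨⟨⟩⟩)
    · rw [affineLetters_t]
      refine ⟨fun k => ?_, fun _ => rfl⟩
      by_cases hk : k = n
      · subst hk; simpa [Affine.t] using he i
      · simp [Affine.t, Finsupp.single_eq_of_ne hk]
    · rw [affineLetters_u]
      exact ⟨by simp [Affine.u], by simp⟩
    · rw [affineLetters_z]
      exact ⟨by simp [Affine.z], by simp⟩
  finite := by
    intro c b
    have key : ∃ F : Set ℤ, F.Finite ∧ ∀ n i, (affineLetters e).repr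
        ((affine L B).bracket (affineLetters e c) (affineLetters e (Sum.inl ⟨n, i⟩))) b ≠ 0 →
        n ∈ F := by
      change ∃ F : Set ℤ, F.Finite ∧ ∀ n i, (affineLetters e).repr
        (affineBracket L B.form (affineLetters e c) (affineLetters e (Sum.inl ⟨n, i⟩))) b ≠ 0 →
        n ∈ F
      simp only [affineLetters_t]
      rcases c with ⟨m, j⟩ | ⟨⟨⟩⟩ | ⟨⟨⟩⟩
      · rcases b with ⟨k, l⟩ | ⟨⟨⟩⟩ | ⟨⟨⟩⟩
        · refine ⟨{k - m}, Set.finite_singleton _, fun n i h => ?_⟩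
          by_contra hn
          refine h ?_
          have hk : k ≠ m + n := fun h' => hn (by simp [h'])
          simp [affineLetters_t, affineLetters_repr_t, affineBracket_apply, Affine.t,
            Finsupp.single_eq_of_ne hk]
        · exact ⟨∅, Set.finite_empty, fun n i h => h (by
            simp [affineLetters_repr_u, affineBracket_apply])⟩
        · refine ⟨{-m}, Set.finite_singleton _, fun n i h => ?_⟩
          by_contra hn
          refine h ?_
          have hk : m ≠ -n := fun h' => hn (by simp [h'])
          simp [affineLetters_t, affineLetters_repr_z, affineBracket_apply, Affine.t, hk]
      · rw [affineLetters_u]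
        simp only [affine_bracket_u]
        rcases b with ⟨k, l⟩ | ⟨⟨⟩⟩ | ⟨⟨⟩⟩
        · refine ⟨{k}, Set.finite_singleton _, fun n i h => ?_⟩
          by_contra hn
          refine h ?_
          have hk : k ≠ n := fun h' => hn (by simp [h'])
          simp [affineLetters_repr_t, Affine.t, Finsupp.single_eq_of_ne hk]
        · exact ⟨∅, Set.finite_empty, fun n i h => h (by
            simp [affineLetters_repr_u, Affine.t])⟩
        · exact ⟨∅, Set.finite_empty, fun n i h => h (by
            simp [affineLetters_repr_z, Affine.t])⟩
      · rw [affineLetters_z]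
        exact ⟨∅, Set.finite_empty, fun n i h => h (by simp [affine_bracket_z])⟩
    obtain ⟨F, hF, h⟩ := key
    have hfin : ((Sum.inl '' ((fun q : ℤ × ι => (⟨q.1, q.2⟩ : Σ _ : ℤ, ι)) '' (F ×ˢ Set.univ)) ∪
        Set.range Sum.inr : Set ((Σ _ : ℤ, ι) ⊕ Unit ⊕ Unit))).Finite :=
      (((hF.prod Set.finite_univ).image _).image _).union (Set.finite_range _)
    refine hfin.subset ?_
    rintro (⟨n, i⟩ | a) ha
    · exact Or.inl ⟨⟨n, i⟩, ⟨(n, i), ⟨h n i ha, trivial⟩, rfl⟩, rfl⟩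
    · exact Or.inr ⟨a, rfl⟩

variable [Fintype ι] [DecidableEq ι]

/-- The matrix `(b_{ij})` inverse to the Gram matrix `a_{ij} = (eᵢ | eⱼ)`. -/
noncomputable def inverseGram {L : LieSuperalgebra V} (B : EvenInvariantForm L)
    (e : Module.Basis ι ℂ V) : Matrix ι ι ℂ :=
  (Matrix.of fun i j => B.form (e i) (e j))⁻¹

/-- The Gram matrix is invertible. -/
theorem gram_mul_inverseGram {L : LieSuperalgebra V} (B : EvenInvariantForm L)
    (e : Module.Basis ι ℂ V) :
    (Matrix.of fun i j => B.form (e i) (e j)) * inverseGram B e = 1 := by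
  have h := (LinearMap.BilinForm.nondegenerate_iff_det_ne_zero (B := B.form) e).mp B.nondegenerate
  have e1 : LinearMap.BilinForm.toMatrix e B.form
      = Matrix.of fun i j => B.form (e i) (e j) := by
    ext i j
    simp [LinearMap.BilinForm.toMatrix_apply]
  rw [e1] at h
  exact Matrix.mul_nonsing_inv _ (isUnit_iff_ne_zero.mpr h)

/-- The finite sum `∑ᵢⱼ b_{ij} tⁿ eᵢ ⊗ t⁻ⁿ eⱼ`. -/
noncomputable def casimirTerm {L : LieSuperalgebra V} (B : EvenInvariantForm L)
    (e : Module.Basis ι ℂ V) (n : ℤ) : TensorAlgebra ℂ (Affine V) :=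
  ∑ i, ∑ j, inverseGram B e i j •
    (TensorAlgebra.ι ℂ (Affine.t n (e i)) * TensorAlgebra.ι ℂ (Affine.t (-n) (e j)))

/-- The element `Ω' = ∑_{n ∈ ℤ} ∑ᵢⱼ b_{ij} tⁿ eᵢ ⊗ t⁻ⁿ eⱼ` of the completed enveloping algebra of
the Kac–Moody superalgebra. -/
noncomputable def casimirSum (L : LieSuperalgebra V) (B : EvenInvariantForm L)
    (e : Module.Basis ι ℂ V) (p : ι → ZMod 2) (he : ∀ i, e i ∈ L.parity (p i)) :
    EnvHat (affineBasis L B e p he) :=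
  EnvHat.sum (affineBasis L B e p he) (casimirTerm B e)

/-- Each word occurs in only finitely many terms of the infinite sum `Ω'`. -/
theorem casimirTerm_finite (L : LieSuperalgebra V) (B : EvenInvariantForm L)
    (e : Module.Basis ι ℂ V) (p : ι → ZMod 2) (he : ∀ i, e i ∈ L.parity (p i))
    (w : List ((Σ _ : ℤ, ι) ⊕ Unit ⊕ Unit)) :
    {n | coeff (affineBasis L B e p he) (casimirTerm B e n) w ≠ 0}.Finite := by
  have hb : (affineBasis L B e p he).basis = affineLetters e := rfl
  rcases w with _ | ⟨⟨k, l⟩ | ⟨⟨⟩⟩ | ⟨⟨⟩⟩, w⟩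
  · convert Set.finite_empty using 1
    ext n
    simp [casimirTerm, coeff_nil]
  · refine (Set.finite_singleton k).subset fun n hn => ?_
    by_contra h
    refine hn ?_
    have hk : k ≠ n := fun h' => h (by simp [h'])
    simp [casimirTerm, coeff_cons, hb, affineLetters_repr_t, Affine.t,
      Finsupp.single_eq_of_ne hk]
  · convert Set.finite_empty using 1
    ext n
    simp [casimirTerm, coeff_cons, hb, affineLetters_repr_u, Affine.t]
  · convert Set.finite_empty using 1
    ext n
    simp [casimirTerm, coeff_cons, hb, affineLetters_repr_z, Affine.t]

end Casimir

end SuperCasimir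

open SuperCasimir

/-! Write `Ω'` for the infinite sum and `x = eₖ`, and bracket `tᵐ x` with the `n`-th term `∑ b_{ij}
tⁿ eᵢ ⊗ t⁻ⁿ eⱼ`.

The loop part of the bracket acts on both factors. On the first it gives `S_n = ∑ b_{ij} tᵐ⁺ⁿ [x,
eᵢ] ⊗ t⁻ⁿ eⱼ` (`bracketTerm`). The tensor `∑ b_{ij} eᵢ ⊗ eⱼ` is invariant
(`sum_inverseGram_invariant`), so on the second it gives `-S_{n-m}`. Each word occurs in only
finitely many `S_n`, so `∑ S_n` and `∑ S_{n-m}` are the same formal sum and cancel.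

The cocycle contributes only at `n = -m` and `n = m`. There the dual basis expansions
(`sum_inverseGram_right`, `sum_inverseGram_left`) turn the double sum over `i, j` back into `x`,
leaving `m (z ⊗ tᵐ x + tᵐ x ⊗ z)`, which is `2m tᵐ x · z` in the enveloping algebra. The correction
term cancels this: since `z` is central, `[tᵐ x, 2uz] = -2 [u, tᵐ x] z = -2m tᵐ x · z`.

For `u` the degrees `n` and `-n` cancel in every word, and `z` is central. These basis vectors
suffice by linearity. The analytic input is `adWord_finsum`: the termwise bracket commutes with
locally finite sums of words. -/

namespace SuperCasimir

/-! ### Locally finite sums of words and the termwise bracket. -/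

section Completion

variable {W : Type*} [AddCommGroup W] [Module ℂ W] {L : LieSuperalgebra W} {Λ : Type*}
  (β : SummableBasis L Λ)

/-- Bracketing preserves the finiteness of the number of terms in which a given word occurs. -/
theorem adWord_finite {κ : Type*} (f : κ → List Λ → ℂ) (hf : ∀ w, {n | f n w ≠ 0}.Finite)
    (c : Λ) (w : List Λ) : {n | adWord β c w (f n) ≠ 0}.Finite := by
  induction w generalizing f with
  | nil => simp [adWord]
  | cons b w ih =>
    -- A term contributes at `b :: w` in two ways: through one of the finitely many letters `a`
    -- whose bracket with `c` contains `b`, or through the tail `w` with the letter `b` kept.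
    refine (((β.finite c b).biUnion fun a _ => hf (a :: w)).union
      (ih (fun n v => f n (b :: v)) fun v => hf (b :: v))).subset fun n hn => ?_
    by_contra h
    simp only [Set.mem_union, Set.mem_iUnion, Set.mem_ofPred_eq, not_or, not_exists,
      not_not] at h
    refine hn ?_
    rw [adWord_cons, h.2, mul_zero, add_zero]
    refine finsum_eq_zero_of_forall_eq_zero fun a => ?_
    by_cases ha : β.basis.repr (L.bracket (β.basis c) (β.basis a)) b = 0
    · rw [ha, zero_mul]
    · rw [h.1 a ha, mul_zero]

/-- Bracketing of formal sums commutes with infinite sums in which each word occurs in only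
finitely many terms. -/
theorem adWord_finsum {κ : Type*} (f : κ → List Λ → ℂ) (hf : ∀ w, {n | f n w ≠ 0}.Finite)
    (c : Λ) (w : List Λ) :
    adWord β c w (fun v => ∑ᶠ n, f n v) = ∑ᶠ n, adWord β c w (f n) := by
  induction w generalizing f with
  | nil => simp [adWord]
  | cons b w ih =>
    have hf' := fun v => hf (b :: v)
    simp only [adWord_cons]
    rw [ih (fun n v => f n (b :: v)) hf', finsum_add_distrib]
    · congr 1
      -- The letters `a` that matter form one finite set independent of `n`, so the sum over `a` is
      -- a genuine finite sum and can be exchanged with the locally finite sum over `n`.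
      · have hA := β.finite c b
        have hs : ∀ g : Λ → ℂ, (Function.support fun a =>
            β.basis.repr (L.bracket (β.basis c) (β.basis a)) b * g a) ⊆ ↑hA.toFinset :=
          fun g a ha => by
            rw [Set.Finite.coe_toFinset]
            exact left_ne_zero_of_mul ha
        rw [finsum_eq_sum_of_support_subset _ (hs fun a => ∑ᶠ n, f n (a :: w)),
          finsum_congr fun n => finsum_eq_sum_of_support_subset _ (hs fun a => f n (a :: w)),
          finsum_sum_comm]
        · simp only [mul_finsum]
        · exact fun a _ => (hf (a :: w)).subset fun n hn => right_ne_zero_of_mul hn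
      · rw [mul_finsum]
    · refine ((β.finite c b).biUnion fun a _ => hf (a :: w)).subset fun n hn => ?_
      obtain ⟨a, ha⟩ : ∃ a,
          β.basis.repr (L.bracket (β.basis c) (β.basis a)) b * f n (a :: w) ≠ 0 := by
        by_contra! h
        exact hn (finsum_eq_zero_of_forall_eq_zero h)
      exact Set.mem_biUnion (show a ∈ {a | _} from left_ne_zero_of_mul ha)
        (right_ne_zero_of_mul ha)
    · exact (adWord_finite β (fun n v => f n (b :: v)) hf' c w).subset
        fun n hn => right_ne_zero_of_mul hn

/-- The bracket of a basis vector with a sum of words, when the brackets with the terms sum to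
the finite sum of words `y`. -/
theorem bracket_sum {κ : Type*} (v v' : κ → TensorAlgebra ℂ W)
    (hv : ∀ w, {n | coeff β (v n) w ≠ 0}.Finite) (c : Λ) (y : TensorAlgebra ℂ W)
    (h : ∀ n, adFormal β (β.basis c) (coeff β (v n)) = coeff β (v' n))
    (hy : ∀ w, ∑ᶠ n, coeff β (v' n) w = coeff β y w) :
    EnvHat.bracket β (β.basis c) (EnvHat.sum β v) = EnvHat.ofEnv β (Env.proj L y) := by
  rw [EnvHat.ofEnv_proj, EnvHat.sum, EnvHat.bracket, Submodule.mapQ_apply]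
  -- The two representatives already agree coefficient by coefficient; no relation of the enveloping
  -- algebra is needed here.
  congr 1
  funext w
  rw [adFormal_basis, adWord_finsum β _ hv, ← hy]
  refine finsum_congr fun n => ?_
  rw [← h, adFormal_basis]

/-- The Leibniz rule on words of length two. -/
theorem adFormal_coeff_mul (c a b : Λ) :
    adFormal β (β.basis c)
        (coeff β (TensorAlgebra.ι ℂ (β.basis a) * TensorAlgebra.ι ℂ (β.basis b))) =
      coeff β (TensorAlgebra.ι ℂ (L.bracket (β.basis c) (β.basis a)) *
          TensorAlgebra.ι ℂ (β.basis b)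
        + sgn (β.p c) (β.p a) • (TensorAlgebra.ι ℂ (β.basis a) *
          TensorAlgebra.ι ℂ (L.bracket (β.basis c) (β.basis b)))) := by
  refine adFormal_coeff_cons β c a _ _ ?_
  -- The one-letter case: the second letter followed by the empty word, whose bracket is zero.
  have h := adFormal_coeff_cons β c b 1 0 (by rw [adFormal_coeff_one, map_zero])
  simpa using h

end Completion

/-! ### The inverse Gram matrix and invariance of the tensor `∑ b_{ij} eᵢ ⊗ eⱼ`. -/

section Dual

variable {V : Type*} [AddCommGroup V] [Module ℂ V] {L : LieSuperalgebra V}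
  (B : EvenInvariantForm L) {ι : Type*} [Fintype ι] [DecidableEq ι] (e : Module.Basis ι ℂ V)

theorem inverseGram_mul_gram :
    inverseGram B e * (Matrix.of fun i j => B.form (e i) (e j)) = 1 :=
  mul_eq_one_comm.mp (gram_mul_inverseGram B e)

/-- The inverse of the Gram matrix is even. -/
theorem inverseGram_mul_sgn {p : ι → ZMod 2} (he : ∀ i, e i ∈ L.parity (p i)) (s : ZMod 2)
    (i j : ι) : inverseGram B e i j * sgn s (p j) = sgn s (p i) * inverseGram B e i j := by
  set A : Matrix ι ι ℂ := Matrix.of fun i j => B.form (e i) (e j) with hA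
  set D : Matrix ι ι ℂ := Matrix.diagonal fun i => sgn s (p i) with hD
  have h1 : A * inverseGram B e = 1 := gram_mul_inverseGram B e
  have h2 : inverseGram B e * A = 1 := inverseGram_mul_gram B e
  -- Evenness of the form says that the Gram matrix has no entries between different parities, that
  -- is, it commutes with the diagonal matrix of signs. Its inverse then commutes with that matrix
  -- too.
  have h : D * A = A * D := by
    ext k l
    rw [hD, Matrix.diagonal_mul, Matrix.mul_diagonal, hA, Matrix.of_apply]
    by_cases hkl : p k = p l
    · rw [hkl, mul_comm]
    · rw [B.even (he k) (he l) hkl, mul_zero, zero_mul]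
  have h3 : inverseGram B e * D = D * inverseGram B e := by
    calc inverseGram B e * D = inverseGram B e * D * (A * inverseGram B e) := by
          rw [h1, mul_one]
      _ = inverseGram B e * (D * A) * inverseGram B e := by simp only [mul_assoc]
      _ = (inverseGram B e * A) * D * inverseGram B e := by rw [h]; simp only [mul_assoc]
      _ = D * inverseGram B e := by rw [h2, one_mul]
  have h4 := congrFun (congrFun h3 i) j
  rwa [hD, Matrix.diagonal_mul, Matrix.mul_diagonal] at h4

/-- Expansion of a vector in the basis by the form, from the left. -/
theorem sum_inverseGram_left (v : V) :
    ∑ i, ∑ j, (inverseGram B e i j * B.form (e j) v) • e i = v := by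
  -- Both sides are linear in `v`, so `v = eₖ` suffices; there the coefficient of `eᵢ` is the `(i,
  -- k)` entry of the inverse Gram matrix times the Gram matrix.
  have h : ∑ i, ∑ j, (LinearMap.toSpanSingleton ℂ V (e i)).comp
      (inverseGram B e i j • B.form (e j)) = LinearMap.id := by
    refine e.ext fun k => ?_
    have h1 : ∀ i, ∑ j, inverseGram B e i j * B.form (e j) (e k) = (1 : Matrix ι ι ℂ) i k := by
      intro i
      rw [← inverseGram_mul_gram B e, Matrix.mul_apply]
      rfl
    simp [LinearMap.sum_apply, ← Finset.sum_smul, h1, Matrix.one_apply]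
  simpa [LinearMap.sum_apply] using LinearMap.congr_fun h v

/-- Expansion of a vector in the basis by the form, from the right. -/
theorem sum_inverseGram_right (v : V) :
    ∑ i, ∑ j, (inverseGram B e i j * B.form v (e i)) • e j = v := by
  have h : ∑ i, ∑ j, (LinearMap.toSpanSingleton ℂ V (e j)).comp
      (inverseGram B e i j • B.form.flip (e i)) = LinearMap.id := by
    refine e.ext fun k => ?_
    have h1 : ∀ j, ∑ i, inverseGram B e i j * B.form (e k) (e i) = (1 : Matrix ι ι ℂ) k j := by
      intro j
      rw [← gram_mul_inverseGram B e, Matrix.mul_apply]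
      exact Finset.sum_congr rfl fun i _ => mul_comm _ _
    rw [Finset.sum_comm]
    simp [LinearMap.sum_apply, ← Finset.sum_smul, h1, Matrix.one_apply]
  simpa [LinearMap.sum_apply] using LinearMap.congr_fun h v

/-- The element `∑ b_{ij} eᵢ ⊗ eⱼ` is invariant under a homogeneous `x ∈ L`, tested on a bilinear
map `Φ`. -/
theorem sum_inverseGram_invariant {p : ι → ZMod 2} (he : ∀ i, e i ∈ L.parity (p i))
    {a : ZMod 2} {x : V} (hx : x ∈ L.parity a) {M : Type*} [AddCommGroup M] [Module ℂ M]
    (Φ : V →ₗ[ℂ] V →ₗ[ℂ] M) :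
    ∑ i, ∑ j, (inverseGram B e i j * sgn a (p i)) • Φ (e i) (L.bracket x (e j)) =
      -∑ i, ∑ j, inverseGram B e i j • Φ (L.bracket x (e i)) (e j) := by
  -- The two brackets are expanded from opposite sides, so that both sides of the claim become
  -- quadruple sums with the same kind of coefficients.
  have h1 : ∀ i j, Φ (L.bracket x (e i)) (e j) =
      ∑ k, ∑ l, (inverseGram B e k l * B.form (e l) (L.bracket x (e i))) • Φ (e k) (e j) := by
    intro i j
    conv_lhs => rw [← sum_inverseGram_left B e (L.bracket x (e i))]
    simp [LinearMap.sum_apply]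
  have h2 : ∀ i j, Φ (e i) (L.bracket x (e j)) =
      ∑ k, ∑ l, (inverseGram B e k l * B.form (L.bracket x (e j)) (e k)) • Φ (e i) (e l) := by
    intro i j
    conv_lhs => rw [← sum_inverseGram_right B e (L.bracket x (e j))]
    simp
  -- Invariance and skew-symmetry move `x` to the other argument, at the cost of the sign of `e_l`;
  -- since the inverse Gram matrix is even, that sign may be read off from `e_k` instead.
  have h3 : ∀ i k l, inverseGram B e k l * B.form (e l) (L.bracket x (e i)) =
      -(inverseGram B e k l * sgn a (p k) * B.form (L.bracket x (e l)) (e i)) := by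
    intro i k l
    rw [← B.invariant, L.skew (he l) hx, sgn_comm]
    simp only [map_neg, map_smul, LinearMap.neg_apply, LinearMap.smul_apply, smul_eq_mul]
    linear_combination (-B.form (L.bracket x (e l)) (e i)) * inverseGram_mul_sgn B e he a k l
  simp only [h1, h2, h3, Finset.smul_sum, smul_smul]
  have h4 : ∀ G : ι → ι → ι → M, ∑ j, ∑ k, ∑ l, G j k l = ∑ k, ∑ l, ∑ j, G j k l := fun G =>
    by
    rw [Finset.sum_comm]
    exact Finset.sum_congr rfl fun _ _ => Finset.sum_comm
  -- Exchanging the index pairs `(i, j)` and `(k, l)` makes the two quadruple sums agree term by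
  -- term.
  have h5 : ∀ F : ι → ι → ι → ι → M,
      ∑ i, ∑ j, ∑ k, ∑ l, F i j k l = ∑ k, ∑ l, ∑ i, ∑ j, F i j k l := fun F =>
    (Finset.sum_congr rfl fun i _ => h4 (F i)).trans (h4 fun i k l => ∑ j, F i j k l)
  simp only [← Finset.sum_neg_distrib, ← neg_smul]
  rw [h5]
  refine Finset.sum_congr rfl fun i _ => Finset.sum_congr rfl fun j _ =>
    Finset.sum_congr rfl fun k _ => Finset.sum_congr rfl fun l _ => ?_
  congr 1
  ring

end Dual

/-! ### Brackets of the basis vectors with `Ω'` and with `2uz`. -/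

section Casimir

variable {V : Type*} [AddCommGroup V] [Module ℂ V] (L : LieSuperalgebra V)
  (B : EvenInvariantForm L) {ι : Type*} [Fintype ι] [DecidableEq ι] (e : Module.Basis ι ℂ V)
  (p : ι → ZMod 2) (he : ∀ i, e i ∈ L.parity (p i))

/-- The linear map `x ↦ tⁿ x`. -/
noncomputable def Affine.tHom (n : ℤ) : V →ₗ[ℂ] Affine V :=
  LinearMap.inl ℂ (ℤ →₀ V) (ℂ × ℂ) ∘ₗ Finsupp.lsingle n

theorem Affine.tHom_apply (n : ℤ) (x : V) : Affine.tHom n x = Affine.t n x := rfl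

/-- The bilinear map `(x, y) ↦ tᵐ x ⊗ tⁿ y`. -/
noncomputable def tensorT (m n : ℤ) : V →ₗ[ℂ] V →ₗ[ℂ] TensorAlgebra ℂ (Affine V) :=
  (LinearMap.mul ℂ (TensorAlgebra ℂ (Affine V))).compl₁₂
    (TensorAlgebra.ι ℂ ∘ₗ Affine.tHom m)
    (TensorAlgebra.ι ℂ ∘ₗ Affine.tHom n)

theorem tensorT_apply (m n : ℤ) (x y : V) :
    tensorT m n x y =
      TensorAlgebra.ι ℂ (Affine.t m x) * TensorAlgebra.ι ℂ (Affine.t n y) := rfl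

/-- The part `∑ b_{ij} tᵐ⁺ⁿ [x, eᵢ] ⊗ t⁻ⁿ eⱼ` of the bracket of `tᵐ x` with a term of `Ω'`. -/
noncomputable def bracketTerm (m : ℤ) (x : V) (n : ℤ) : TensorAlgebra ℂ (Affine V) :=
  ∑ i, ∑ j, inverseGram B e i j • tensorT (m + n) (-n) (L.bracket x (e i)) (e j)

/-- The first letter of every word in the `n`-th term has degree `m + n`, so a given word determines
`n`. This is what allows the two shifted sums in `bracket_casimirSum_t` to be separated and
cancelled. -/
theorem bracketTerm_finite (m : ℤ) (x : V) (w : List ((Σ _ : ℤ, ι) ⊕ Unit ⊕ Unit)) :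
    {n | coeff (affineBasis L B e p he) (bracketTerm L B e m x n) w ≠ 0}.Finite := by
  have hb : (affineBasis L B e p he).basis = affineLetters e := rfl
  rcases w with _ | ⟨⟨k, l⟩ | ⟨⟨⟩⟩ | ⟨⟨⟩⟩, w⟩
  · simp [bracketTerm, coeff_nil, tensorT_apply]
  · refine (Set.finite_singleton (k - m)).subset fun n hn => ?_
    by_contra h
    refine hn ?_
    have hk : k ≠ m + n := fun h' => h (by simp [h'])
    simp [bracketTerm, tensorT_apply, coeff_cons, hb, affineLetters_repr_t, Affine.t,
      Finsupp.single_eq_of_ne hk]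
  · simp [bracketTerm, tensorT_apply, coeff_cons, hb, affineLetters_repr_u, Affine.t]
  · simp [bracketTerm, tensorT_apply, coeff_cons, hb, affineLetters_repr_z, Affine.t]

/-- The loop part of the bracket becomes a difference of two values of one sequence, at `n` and at
`n - m`, ready to cancel after summation. The two conditional terms are the cocycle on the first and
on the second tensor factor. -/
theorem adFormal_casimirTerm_t (m : ℤ) (k : ι) (n : ℤ) :
    adFormal (affineBasis L B e p he) ((affineBasis L B e p he).basis (Sum.inl ⟨m, k⟩))
        (coeff (affineBasis L B e p he) (casimirTerm B e n)) =
      coeff (affineBasis L B e p he)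
        (bracketTerm L B e m (e k) n - bracketTerm L B e m (e k) (n - m)
          + ((if m = -n then (m : ℂ) else 0) •
              (TensorAlgebra.ι ℂ Affine.z * TensorAlgebra.ι ℂ (Affine.t m (e k)))
            + (if n = m then (m : ℂ) else 0) •
              (TensorAlgebra.ι ℂ (Affine.t m (e k)) * TensorAlgebra.ι ℂ Affine.z))) := by
  set β := affineBasis L B e p he with hβ
  have ht : ∀ m i, β.basis (Sum.inl ⟨m, i⟩) = Affine.t m (e i) := affineLetters_t e
  have h : ∀ i j, adFormal β (β.basis (Sum.inl ⟨m, k⟩)) (coeff β (TensorAlgebra.ι ℂ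
      (Affine.t n (e i)) * TensorAlgebra.ι ℂ (Affine.t (-n) (e j)))) =
      coeff β (tensorT (m + n) (-n) (L.bracket (e k) (e i)) (e j)
        + sgn (p k) (p i) • tensorT n (m - n) (e i) (L.bracket (e k) (e j))
        + ((if m = -n then (m : ℂ) * B.form (e k) (e i) else 0) •
            (TensorAlgebra.ι ℂ Affine.z * TensorAlgebra.ι ℂ (Affine.t (-n) (e j)))
          + (sgn (p k) (p i) * (if m = n then (m : ℂ) * B.form (e k) (e j) else 0)) •
            (TensorAlgebra.ι ℂ (Affine.t n (e i)) * TensorAlgebra.ι ℂ Affine.z))) := by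
    intro i j
    rw [← ht n i, ← ht (-n) j, adFormal_coeff_mul]
    congr 1
    simp only [ht]
    change TensorAlgebra.ι ℂ (affineBracket L B.form _ _) * _ + sgn (p k) (p i) • (_ *
      TensorAlgebra.ι ℂ (affineBracket L B.form _ _)) = _
    simp only [affine_bracket_t, tensorT_apply, map_add, map_smul, add_mul, mul_add, neg_neg,
      smul_mul_assoc, mul_smul_comm, smul_add, smul_smul, sub_eq_add_neg]
    abel
  simp only [casimirTerm, map_sum, map_smul, h]
  -- Everything is collected under `coeff`, leaving an identity in the tensor algebra itself.
  simp only [← map_sum, ← map_smul (coeff β)]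
  congr 1
  simp only [smul_add, Finset.sum_add_distrib, smul_smul]
  congr 1
  -- Invariance, tested on `tensorT n (m - n)`, moves the bracket from the second factor to the
  -- first; the exponents `n` and `m - n` are those of `bracketTerm` at `n - m`.
  · rw [sum_inverseGram_invariant B e he (he k), ← sub_eq_add_neg, bracketTerm, bracketTerm,
      neg_sub, add_sub_cancel]
  · congr 1
    · split_ifs with hmn
      -- The form pairs `eₖ` with `eᵢ`, so the expansion from the right rebuilds `eₖ` in the second
      -- factor.
      · obtain rfl : n = -m := by omega
        have h1 := congrArg (LinearMap.mulLeft ℂ (TensorAlgebra.ι ℂ Affine.z) ∘ₗ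
          TensorAlgebra.ι ℂ ∘ₗ Affine.tHom m) (sum_inverseGram_right B e (e k))
        simp only [map_sum, map_smul, LinearMap.comp_apply, LinearMap.mulLeft_apply,
          Affine.tHom_apply] at h1
        rw [← h1]
        simp only [Finset.smul_sum, smul_smul, neg_neg, mul_left_comm]
      · simp
    · split_ifs with hmn hmn' hmn'
      · subst hmn
        have h1 := congrArg (LinearMap.mulRight ℂ (TensorAlgebra.ι ℂ Affine.z) ∘ₗ
          TensorAlgebra.ι ℂ ∘ₗ Affine.tHom m) (sum_inverseGram_left B e (e k))
        simp only [map_sum, map_smul, LinearMap.comp_apply, LinearMap.mulRight_apply,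
          Affine.tHom_apply] at h1
        rw [← h1]
        simp only [Finset.smul_sum, smul_smul]
        refine Finset.sum_congr rfl fun i _ => Finset.sum_congr rfl fun j _ => ?_
        congr 1
        -- The Leibniz sign involves `eᵢ` and the supersymmetry sign involves `eⱼ`; they agree
        -- wherever `b_{ij}` is nonzero.
        rw [B.supersymm (he j) (he k), smul_eq_mul, sgn_comm (p j)]
        linear_combination (-(m : ℂ) * B.form (e k) (e j)) *
          inverseGram_mul_sgn B e he (p k) i j
      · exact absurd hmn.symm hmn'
      · exact absurd hmn'.symm hmn
      · simp

/-- `u` acts on a word by its total degree, here `n + (-n) = 0`. The zero is written as `coeff` of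
`0` to match the hypothesis of `bracket_sum`. -/
theorem adFormal_casimirTerm_u (n : ℤ) :
    adFormal (affineBasis L B e p he) ((affineBasis L B e p he).basis (Sum.inr (Sum.inl ())))
        (coeff (affineBasis L B e p he) (casimirTerm B e n)) =
      coeff (affineBasis L B e p he) 0 := by
  set β := affineBasis L B e p he with hβ
  have ht : ∀ m i, β.basis (Sum.inl ⟨m, i⟩) = Affine.t m (e i) := affineLetters_t e
  have hu : β.basis (Sum.inr (Sum.inl ())) = Affine.u := affineLetters_u e
  simp only [casimirTerm, map_sum, map_smul, map_zero]
  refine Finset.sum_eq_zero fun i _ => Finset.sum_eq_zero fun j _ => ?_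
  rw [← ht n i, ← ht (-n) j, adFormal_coeff_mul]
  simp only [ht, hu]
  change _ • coeff β (TensorAlgebra.ι ℂ (affineBracket L B.form _ _) * _ + sgn 0 (p i) • (_ *
      TensorAlgebra.ι ℂ (affineBracket L B.form _ _))) = 0
  simp [affine_bracket_u]

theorem adFormal_casimirTerm_z (n : ℤ) :
    adFormal (affineBasis L B e p he) ((affineBasis L B e p he).basis (Sum.inr (Sum.inr ())))
        (coeff (affineBasis L B e p he) (casimirTerm B e n)) =
      coeff (affineBasis L B e p he) 0 := by
  set β := affineBasis L B e p he with hβ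
  have ht : ∀ m i, β.basis (Sum.inl ⟨m, i⟩) = Affine.t m (e i) := affineLetters_t e
  have hz : β.basis (Sum.inr (Sum.inr ())) = Affine.z := affineLetters_z e
  simp only [casimirTerm, map_sum, map_smul, map_zero]
  refine Finset.sum_eq_zero fun i _ => Finset.sum_eq_zero fun j _ => ?_
  rw [← ht n i, ← ht (-n) j, adFormal_coeff_mul]
  simp only [ht, hz]
  change _ • coeff β (TensorAlgebra.ι ℂ (affineBracket L B.form _ _) * _ + sgn 0 (p i) • (_ *
      TensorAlgebra.ι ℂ (affineBracket L B.form _ _))) = 0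
  simp [affine_bracket_z]

/-- `[tᵐ eₖ, Ω'] = m (z ⊗ tᵐ eₖ + tᵐ eₖ ⊗ z)`. -/
theorem bracket_casimirSum_t (m : ℤ) (k : ι) :
    EnvHat.bracket (affineBasis L B e p he) ((affineBasis L B e p he).basis (Sum.inl ⟨m, k⟩))
        (casimirSum L B e p he) =
      EnvHat.ofEnv (affineBasis L B e p he) (Env.proj (affine L B)
        ((m : ℂ) • (TensorAlgebra.ι ℂ Affine.z * TensorAlgebra.ι ℂ (Affine.t m (e k)))
          + (m : ℂ) • (TensorAlgebra.ι ℂ (Affine.t m (e k)) * TensorAlgebra.ι ℂ Affine.z))) := by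
  refine bracket_sum _ _ _ (casimirTerm_finite L B e p he) _ _
    (adFormal_casimirTerm_t L B e p he m k) fun w => ?_
  have hS := bracketTerm_finite L B e p he m (e k) w
  have hS' : {n | coeff (affineBasis L B e p he) (bracketTerm L B e m (e k) (n - m)) w
      ≠ 0}.Finite := hS.preimage (sub_left_injective.injOn (s := _))
  have h1 : {n : ℤ | (if m = -n then (m : ℂ) else 0) ≠ 0}.Finite :=
    (Set.finite_singleton (-m)).subset fun n hn => by
      by_contra h
      exact hn (if_neg fun h' => h (by simp [h']))
  have h2 : {n : ℤ | (if n = m then (m : ℂ) else 0) ≠ 0}.Finite :=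
    (Set.finite_singleton m).subset fun n hn => by
      by_contra h
      exact hn (if_neg h)
  simp only [map_add, map_sub, map_smul, Pi.add_apply, Pi.sub_apply, Pi.smul_apply, smul_eq_mul]
  have h1' := fun r : ℂ => h1.subset (fun n => left_ne_zero_of_mul (b := r))
  have h2' := fun r : ℂ => h2.subset (fun n => left_ne_zero_of_mul (b := r))
  -- `finsum` takes the value `0` on infinite supports, so each splitting needs finiteness of the
  -- separate pieces.
  rw [finsum_add_distrib, finsum_add_distrib, finsum_sub_distrib hS hS']
  -- Translation by `m` is a bijection of `ℤ`, so the shifted sum equals the unshifted one.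
  · have h3 : ∑ᶠ n, coeff (affineBasis L B e p he) (bracketTerm L B e m (e k) (n - m)) w =
        ∑ᶠ n, coeff (affineBasis L B e p he) (bracketTerm L B e m (e k) n) w :=
      finsum_comp_equiv (Equiv.subRight m)
        (f := fun n => coeff (affineBasis L B e p he) (bracketTerm L B e m (e k) n) w)
    rw [h3, sub_self, zero_add, finsum_eq_single _ (-m), finsum_eq_single _ m]
    · simp
    · intro n hn
      rw [if_neg hn, zero_mul]
    · intro n hn
      rw [if_neg fun h' => hn (by simp [h']), zero_mul]
  · exact h1' _
  · exact h2' _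
  · exact Function.HasFiniteSupport.sub hS hS'
  · exact Function.HasFiniteSupport.add (h1' _) (h2' _)

theorem bracket_casimirSum_u :
    EnvHat.bracket (affineBasis L B e p he) Affine.u (casimirSum L B e p he) = 0 := by
  have h := bracket_sum _ _ (fun _ => 0) (casimirTerm_finite L B e p he) _ 0
    (adFormal_casimirTerm_u L B e p he) (by simp)
  rw [map_zero, map_zero] at h
  rw [← affineLetters_u e]
  exact h

theorem bracket_casimirSum_z :
    EnvHat.bracket (affineBasis L B e p he) Affine.z (casimirSum L B e p he) = 0 := by
  have h := bracket_sum _ _ (fun _ => 0) (casimirTerm_finite L B e p he) _ 0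
    (adFormal_casimirTerm_z L B e p he) (by simp)
  rw [map_zero, map_zero] at h
  rw [← affineLetters_z e]
  exact h

theorem Affine.u_mem : (Affine.u : Affine V) ∈ (affine L B).parity 0 :=
  ⟨by simp [Affine.u], by simp⟩

theorem Affine.z_mem : (Affine.z : Affine V) ∈ (affine L B).parity 0 :=
  ⟨by simp [Affine.z], by simp⟩

theorem Env.z_comm {a : ZMod 2} {X : Affine V} (hX : X ∈ (affine L B).parity a) :
    Env.ι (affine L B) Affine.z * Env.ι (affine L B) X =
      Env.ι (affine L B) X * Env.ι (affine L B) Affine.z := by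
  rw [Env.comm _ (Affine.z_mem L B) hX]
  have h : (affine L B).bracket Affine.z X = 0 := affine_bracket_z L B.form X
  rw [h, map_zero, add_zero, sgn_zero_left, one_smul]

/-- `[X, 2uz]` in the enveloping algebra. -/
theorem Env.superComm_u_mul_z {a : ZMod 2} {X : Affine V} (hX : X ∈ (affine L B).parity a) :
    Env.superComm (affine L B) a X
        ((2 : ℂ) • (Env.ι (affine L B) Affine.u * Env.ι (affine L B) Affine.z)) =
      -((2 : ℂ) • (Env.ι (affine L B) ((affine L B).bracket Affine.u X) *
        Env.ι (affine L B) Affine.z)) := by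
  simp only [Env.superComm, map_smul, map_mul, Env.sign_ι _ _ (Affine.u_mem L B),
    Env.sign_ι _ _ (Affine.z_mem L B), sgn_zero_right, one_smul, smul_mul_assoc, mul_smul_comm]
  -- Moving `z` to the right turns `X u z - u z X` into `(X u - u X) z`, and `u` is even, so no sign
  -- appears.
  rw [mul_assoc (Env.ι (affine L B) Affine.u), Env.z_comm L B hX,
    ← mul_assoc (Env.ι (affine L B) Affine.u), Env.comm _ (Affine.u_mem L B) hX, sgn_zero_left,
    one_smul, add_mul, smul_add, mul_assoc]
  abel

end Casimir
end SuperCasimir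

theorem mainTheorem3 {V : Type*} [AddCommGroup V] [Module ℂ V]
    (L : LieSuperalgebra V) (B : EvenInvariantForm L)
    {ι : Type*} [Fintype ι] [DecidableEq ι] (e : Module.Basis ι ℂ V)
    (p : ι → ZMod 2) (he : ∀ i, e i ∈ L.parity (p i)) (X : Affine V) :
    EnvHat.bracket (affineBasis L B e p he) X
      (EnvHat.ofEnv (affineBasis L B e p he)
          ((2 : ℂ) • (Env.ι (affine L B) Affine.u * Env.ι (affine L B) Affine.z))
        + casimirSum L B e p he) = 0 := by
  set β := affineBasis L B e p he with hβ
  set ω : EnvHat β := EnvHat.ofEnv β ((2 : ℂ) • (Env.ι (affine L B) Affine.u *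
    Env.ι (affine L B) Affine.z)) + casimirSum L B e p he with hω
  obtain ⟨f, hf⟩ := Submodule.Quotient.mk_surjective _ ω
  -- `EnvHat.bracket` is bundled as linear only in its second argument. With a representative `f`
  -- fixed, the bracket is a linear map of `X`, so basis vectors suffice; they are homogeneous, as
  -- the supercommutator formula requires.
  suffices h : (relations β).mkQ ∘ₗ (adFormal β).flip f = 0 by
    rw [← hf]
    exact LinearMap.congr_fun h X
  refine β.basis.ext fun c => ?_
  change EnvHat.bracket β (β.basis c) (Submodule.Quotient.mk f) = 0
  rw [hf, hω, map_add, EnvHat.bracket_ofEnv β (β.mem c),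
    Env.superComm_u_mul_z L B (β.mem c)]
  change EnvHat.ofEnv β (-((2 : ℂ) • (Env.ι (affine L B)
    (affineBracket L B.form Affine.u (β.basis c)) * _))) + _ = 0
  rcases c with ⟨m, k⟩ | ⟨⟨⟩⟩ | ⟨⟨⟩⟩
  · have ht : β.basis (Sum.inl ⟨m, k⟩) = Affine.t m (e k) := affineLetters_t e m k
    have hz := Env.z_comm L B (β.mem (Sum.inl ⟨m, k⟩))
    rw [bracket_casimirSum_t, ← map_add]
    rw [ht] at hz ⊢
    rw [affine_bracket_u]
    -- Here `z` is commuted past `tᵐ eₖ`, merging the two cocycle terms into `2m tᵐ eₖ · z` against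
    -- `-2m tᵐ eₖ · z`.
    simp only [map_add, map_smul, map_mul, Env.proj_ι, hz, smul_mul_assoc, smul_smul, map_neg]
    module
  · have hu : β.basis (Sum.inr (Sum.inl ())) = Affine.u := affineLetters_u e
    have h : affineBracket L B.form Affine.u Affine.u = 0 := by
      simp [affineBracket_apply, Affine.u, Prod.ext_iff]
    rw [hu, bracket_casimirSum_u, h]
    simp
  · have hz : β.basis (Sum.inr (Sum.inr ())) = Affine.z := affineLetters_z e
    have h : affineBracket L B.form Affine.u Affine.z = 0 := by
      simp [affineBracket_apply, Affine.u, Affine.z, Prod.ext_iff]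
    rw [hz, bracket_casimirSum_z, h]
    simp
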